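/- Let $\alpha\in(0,1)$. For $m\in\mathbb N_0$ the diagonal Padé approximant of $(1+t)^{-\alpha}$ is $r_m=P_m/Q_m$, where $P_m,Q_m$ are real polynomials of degree at most $m$ with $Q_m(0)=1$ such that the Taylor expansions at $t=0$ of $P_m(t)/Q_m(t)$ and of $(1+t)^{-\alpha}$ have the same coefficients up to $t^{2m}$. Put $$K_\alpha=\frac{\alpha\pi}{2\,\Gamma(1-\alpha)\,\Gamma(1+\alpha)} .$$ Then the following hold. 1. For every $\alpha\in(0,1)$ and every $m\ge 0$ such a pair $(P_m,Q_m)$ exists and is unique. 2. For every $\alpha\in(0,1)$ and every $t>0$, $$1=r_0(t)>r_1(t)>r_2(t)>\cdots>r_m(t)>\cdots>(1+t)^{-\alpha},$$ while $r_m(0)=1=(1+0)^{-\alpha}$ for all $m\ge0$. 3. There are numbers $c'_\alpha$, $\alpha\in(0,1)$, and constants $A,B>0$ independent of $\alpha$ with $A K_\alpha\le c'_\alpha\le B K_\alpha$, such that for all $\alpha\in(0,1)$, all $m\ge1$ and all $t\in[0,1]$ $$r_m(t)-(1+t)^{-\alpha}\le c'_\alpha\,\frac{2^{-4m}\,t^{2m+1}}{2^{mt}}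 .$$ 4. For large $m$ the constant can be taken arbitrarily close to $K_\alpha$, uniformly in $\alpha$: for every $\varepsilon>0$ there is $M$ such that for all $m\ge M$, all $\alpha\in(0,1)$ and all $t\in[0,1]$ $$r_m(t)-(1+t)^{-\alpha}\le (1+\varepsilon)\,K_\alpha\,\frac{2^{-4m}\,t^{2m+1}}{2^{mt}} .$$ -/

import Mathlib

noncomputable section

/-- `P / Q` is a Padé approximant of type `(m, n)` of `f` at `0`: `P` and `Q` are polynomials of
degree at most `m` and `n`, normalized by `Q 0 = 1`, such that the Taylor expansions at `0` of `f`
and of `P / Q` have the same coefficients up to order `m + n`. -/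
structure IsPade (f : ℝ → ℝ) (m n : ℕ) (P Q : Polynomial ℝ) : Prop where
  natDegree_num_le : P.natDegree ≤ m
  natDegree_den_le : Q.natDegree ≤ n
  den_eval_zero : Q.eval 0 = 1
  taylor_coeff_eq : ∀ k ≤ m + n,
    iteratedDeriv k (fun t : ℝ => P.eval t / Q.eval t) 0 / (k.factorial : ℝ) =
      iteratedDeriv k f 0 / (k.factorial : ℝ)

/-- The function `t ↦ (1 + t) ^ (-α)`. -/
def powFun (α : ℝ) (t : ℝ) : ℝ := (1 + t) ^ (-α)

open Classical in
/-- The value at `t` of the Padé approximant of type `(m, n)` of `f` (and `0` if there is none). -/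
def padeApprox (f : ℝ → ℝ) (m n : ℕ) (t : ℝ) : ℝ :=
  if h : ∃ p : Polynomial ℝ × Polynomial ℝ, IsPade f m n p.1 p.2 then
    (Classical.choose h).1.eval t / (Classical.choose h).2.eval t
  else 0

/-- The diagonal Padé approximant `r_m` of `(1 + t) ^ (-α)`. -/
def padeR (α : ℝ) (m : ℕ) (t : ℝ) : ℝ := padeApprox (powFun α) m m t

/-- The constant `α π / (2 Γ(1 - α) Γ(1 + α))`. -/
def padeConst (α : ℝ) : ℝ :=
  α * Real.pi / (2 * Real.Gamma (1 - α) * Real.Gamma (1 + α))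

/-- The rate `2 ^ (-4m) t ^ (2m + 1) / 2 ^ (m t)`. -/
def padeRate (m : ℕ) (t : ℝ) : ℝ :=
  (2 : ℝ) ^ (-4 * (m : ℝ)) * t ^ (2 * m + 1) / (2 : ℝ) ^ ((m : ℝ) * t)

end

/-!
The numerators and denominators of the diagonal Padé approximants of `(1 + t) ^ (-α)` satisfy
one three-term recurrence, and the numerator is the denominator with `α` replaced by `-α`. With
`Q_m = den α m`, `P_m = den (-α) m` defined by that recurrence, everything follows from two
identities proved by induction, where `d_m = gap α m > 0`:

* `P_m Q_{m+1} - P_{m+1} Q_m = d_m t ^ (2 m + 1)` (`eval_cross_succ`);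
* `(1 + t) (P_m' Q_m - P_m Q_m') + α P_m Q_m = (2 m + 1) d_m t ^ (2 m)` (`eval_wronskian`).

The second identity says that `(P_m / Q_m) (1 + t) ^ α` has derivative
`(2 m + 1) d_m t ^ (2 m) (1 + t) ^ (α - 1) / Q_m ^ 2`. Since this vanishes to order `2 m` at `0`,
`P_m / Q_m` is a Padé approximant (`isPade_den`); since it is positive for `t > 0`, the approximant
lies above the function (`rpow_neg_lt_ratio`). The first identity gives the strict monotonicity in
`m` (`ratio_succ_lt`), and the coprimality of `P_m` and `Q_m`, hence uniqueness (`IsPade.eq_den`).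

For the error bound, the recurrence yields `Q_{m+1} ≥ (1 + (5 / 12) t) Q_m ≥ 2 ^ (t / 2) Q_m` on
`[0, 1]`, so that `Q_m ^ 2 ≥ 2 ^ (m t)` (`two_rpow_le_sq_eval_den`). Comparing derivatives, the
error is at most `d_m t ^ (2 m + 1) 2 ^ (-m t)` (`ratio_sub_le`). Finally `16 ^ m d_m` is a partial
product of Euler's product for `sin (π α) / π` times a partial product of Wallis' product for
`π / 2`, which gives `16 ^ m d_m ≤ (1 + 1 / m) sin (π α) / 2` uniformly in `α` (`gap_le`); and
`padeConst α = sin (π α) / 2` by the reflection formula.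
-/

namespace PowPade

open Polynomial Filter Topology

/-! ### The three-term recurrence -/

/-- The coefficient `(m² - α²) / (4 (4 m² - 1))` of the three-term recurrence that the diagonal
Padé numerators and denominators of `(1 + t) ^ (-α)` share. -/
noncomputable def recCoeff (α : ℝ) (m : ℕ) : ℝ :=
  ((m : ℝ) ^ 2 - α ^ 2) / (4 * (4 * (m : ℝ) ^ 2 - 1))

/-- The denominator of the diagonal Padé approximant of type `(m, m)` of `(1 + t) ^ (-α)`, defined
by its three-term recurrence. Exchanging `α` and `-α` inverts the function, so the numerator
is `den (-α) m`. -/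
noncomputable def den (α : ℝ) : ℕ → ℝ[X]
  | 0 => 1
  | 1 => 1 + C ((1 + α) / 2) * X
  | m + 2 => (1 + C (1 / 2) * X) * den α (m + 1) - C (recCoeff α (m + 1)) * X ^ 2 * den α m

/-- The constant `α λ₁ ⋯ λ_m`, with `λ_j = recCoeff α j`, to which every cross product formed
from consecutive approximants is proportional. -/
noncomputable def gap (α : ℝ) (m : ℕ) : ℝ := α * ∏ j ∈ Finset.range m, recCoeff α (j + 1)

lemma recCoeff_neg (α : ℝ) (m : ℕ) : recCoeff (-α) m = recCoeff α m := by simp [recCoeff]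

lemma den_add_two (α : ℝ) (m : ℕ) :
    den α (m + 2) =
      (1 + C (1 / 2) * X) * den α (m + 1) - C (recCoeff α (m + 1)) * X ^ 2 * den α m := rfl

lemma gap_succ (α : ℝ) (m : ℕ) : gap α (m + 1) = gap α m * recCoeff α (m + 1) := by
  rw [gap, gap, Finset.prod_range_succ, mul_assoc]

lemma recCoeff_succ_pos {α : ℝ} (hα : α ∈ Set.Ioo (0 : ℝ) 1) (m : ℕ) :
    0 < recCoeff α (m + 1) := by
  obtain ⟨h0, h1⟩ := hα
  have hm : (0 : ℝ) ≤ m := m.cast_nonneg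
  unfold recCoeff
  push_cast
  apply div_pos <;> nlinarith

lemma gap_pos {α : ℝ} (hα : α ∈ Set.Ioo (0 : ℝ) 1) (m : ℕ) : 0 < gap α m :=
  mul_pos hα.1 (Finset.prod_pos fun j _ => recCoeff_succ_pos hα j)

lemma eval_den_add_two (α t : ℝ) (m : ℕ) :
    (den α (m + 2)).eval t =
      (1 + t / 2) * (den α (m + 1)).eval t - recCoeff α (m + 1) * t ^ 2 * (den α m).eval t := by
  simp only [den_add_two, eval_sub, eval_mul, eval_add, eval_one, eval_C, eval_X, eval_pow]; ring

lemma eval_derivative_den_add_two (α t : ℝ) (m : ℕ) :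
    (derivative (den α (m + 2))).eval t =
      1 / 2 * (den α (m + 1)).eval t + (1 + t / 2) * (derivative (den α (m + 1))).eval t
        - recCoeff α (m + 1) * (2 * t * (den α m).eval t
          + t ^ 2 * (derivative (den α m)).eval t) := by
  simp only [den_add_two, derivative_sub, derivative_mul, derivative_add, derivative_one,
    derivative_C, derivative_X, derivative_X_pow, eval_sub, eval_mul, eval_add, eval_one, eval_C,
    eval_X, eval_pow, eval_zero, Nat.cast_ofNat, Nat.add_one_sub_one, pow_one]
  ring

lemma natDegree_den_le (α : ℝ) (m : ℕ) : (den α m).natDegree ≤ m := by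
  induction m using Nat.twoStepInduction with
  | zero => simp [den]
  | one => rw [den]; compute_degree
  | more m ih1 ih2 =>
    rw [den_add_two]
    refine (natDegree_sub_le _ _).trans (max_le ?_ ?_)
    · refine natDegree_mul_le_of_le (m := 1) ?_ ih2 |>.trans (by omega)
      compute_degree
    · refine natDegree_mul_le_of_le (m := 2) ?_ ih1 |>.trans (by omega)
      compute_degree

lemma eval_den_zero (α : ℝ) (m : ℕ) : (den α m).eval 0 = 1 := by
  induction m using Nat.twoStepInduction with
  | zero => simp [den]
  | one => simp [den]
  | more m ih1 ih2 => simp [eval_den_add_two, ih2]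

/-- The leading coefficients satisfy a first-order recurrence. -/
lemma coeff_den_succ (α : ℝ) (m : ℕ) :
    (den α (m + 1)).coeff (m + 1) = (m + 1 + α) / (2 * (2 * m + 1)) * (den α m).coeff m := by
  induction m with
  | zero => simp [den, coeff_one]
  | succ m ih =>
    have h1 : (den α (m + 1)).coeff (m + 2) = 0 :=
      coeff_eq_zero_of_natDegree_lt (by have := natDegree_den_le α (m + 1); omega)
    have h2 : (den α (m + 2)).coeff (m + 2) =
        1 / 2 * (den α (m + 1)).coeff (m + 1) - recCoeff α (m + 1) * (den α m).coeff m := by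
      rw [den_add_two, coeff_sub, mul_assoc (C (recCoeff α (m + 1))), coeff_C_mul, coeff_X_pow_mul,
        add_mul, one_mul, coeff_add, h1, mul_assoc, coeff_C_mul, coeff_X_mul]
      ring
    have hm : (0 : ℝ) ≤ m := m.cast_nonneg
    have e : (4 : ℝ) * ((m : ℝ) + 1) ^ 2 - 1 = (2 * m + 1) * (2 * m + 3) := by ring
    have e3 : (2 * ((m : ℝ) + 1) + 1) = 2 * m + 3 := by ring
    rw [h2, ih, recCoeff]
    push_cast
    rw [e, e3]
    field_simp
    ring

lemma coeff_den_pos {α : ℝ} (hα : -1 < α) (m : ℕ) : 0 < (den α m).coeff m := by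
  induction m with
  | zero => simp [den]
  | succ m ih =>
    rw [coeff_den_succ]
    have hm : (0 : ℝ) ≤ m := m.cast_nonneg
    have : 0 < (m : ℝ) + 1 + α := by linarith
    positivity

/-! ### Cross products of numerators and denominators -/

lemma eval_cross_succ (α t : ℝ) (m : ℕ) :
    (den (-α) m).eval t * (den α (m + 1)).eval t - (den (-α) (m + 1)).eval t * (den α m).eval t
      = gap α m * t ^ (2 * m + 1) := by
  induction m with
  | zero => simp [den, gap]; ring
  | succ m ih =>
    rw [eval_den_add_two, eval_den_add_two, gap_succ, recCoeff_neg]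
    linear_combination recCoeff α (m + 1) * t ^ 2 * ih

/-- The relation between consecutive coefficients on which the induction in
`eval_wronskian_triple` rests. -/
lemma recCoeff_succ_mul (α : ℝ) (m : ℕ) :
    (2 * m + 5) * recCoeff α (m + 2) = 1 / 4 + (2 * m + 1) * recCoeff α (m + 1) := by
  have hm : (0 : ℝ) ≤ m := m.cast_nonneg
  have e1 : (4 : ℝ) * ((m : ℝ) + 1) ^ 2 - 1 = (2 * m + 1) * (2 * m + 3) := by ring
  have e2 : (4 : ℝ) * ((m : ℝ) + 2) ^ 2 - 1 = (2 * m + 3) * (2 * m + 5) := by ring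
  simp only [recCoeff]
  push_cast
  rw [e1, e2]
  field_simp
  ring

/-- The form `(P, Q) ↦ (1 + t) (P' Q - P Q') + α P Q` at `(den (-α) m, den α m)`, its
polarization between `m` and `m + 1`, and its value at `m + 1`: these three quantities
form a system that is closed under the recurrence. -/
lemma eval_wronskian_triple (α t : ℝ) (m : ℕ) :
    (1 + t) * ((derivative (den (-α) m)).eval t * (den α m).eval t
        - (den (-α) m).eval t * (derivative (den α m)).eval t)
      + α * ((den (-α) m).eval t * (den α m).eval t) = (2 * m + 1) * gap α m * t ^ (2 * m) ∧
    (1 + t) * ((derivative (den (-α) (m + 1))).eval t * (den α m).eval t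
        - (den (-α) (m + 1)).eval t * (derivative (den α m)).eval t
        + (derivative (den (-α) m)).eval t * (den α (m + 1)).eval t
        - (den (-α) m).eval t * (derivative (den α (m + 1))).eval t)
      + α * ((den (-α) (m + 1)).eval t * (den α m).eval t
        + (den (-α) m).eval t * (den α (m + 1)).eval t) =
      gap α m * t ^ (2 * m) * (2 * m + 1 + m * t) ∧
    (1 + t) * ((derivative (den (-α) (m + 1))).eval t * (den α (m + 1)).eval t
        - (den (-α) (m + 1)).eval t * (derivative (den α (m + 1))).eval t)
      + α * ((den (-α) (m + 1)).eval t * (den α (m + 1)).eval t) =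
      (2 * m + 3) * gap α (m + 1) * t ^ (2 * m + 2) := by
  induction m with
  | zero =>
    refine ⟨?_, ?_, ?_⟩
    · simp [den, gap]
    · simp [den, gap]; ring
    · simp [den, gap, recCoeff]; ring
  | succ m ih =>
    obtain ⟨hW, hS, hW'⟩ := ih
    have hD := eval_cross_succ α t m
    have hr := recCoeff_succ_mul α m
    have hg := gap_succ α m
    have hg' := gap_succ α (m + 1)
    refine ⟨?_, ?_, ?_⟩
    · push_cast
      linear_combination hW'
    · rw [eval_den_add_two, eval_den_add_two, eval_derivative_den_add_two,
        eval_derivative_den_add_two, recCoeff_neg]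
      push_cast
      rw [hg] at hW' ⊢
      linear_combination 2 * (1 + t / 2) * hW' - recCoeff α (m + 1) * t ^ 2 * hS
        - 2 * recCoeff α (m + 1) * t * (1 + t) * hD
    · rw [eval_den_add_two, eval_den_add_two, eval_derivative_den_add_two,
        eval_derivative_den_add_two, recCoeff_neg, hg']
      push_cast
      rw [hg] at hW' ⊢
      linear_combination (1 + t / 2) ^ 2 * hW' - recCoeff α (m + 1) * t ^ 2 * (1 + t / 2) * hS
        + recCoeff α (m + 1) ^ 2 * t ^ 4 * hW
        - (1 + t) * (2 * recCoeff α (m + 1) * t + recCoeff α (m + 1) * t ^ 2 / 2) * hD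
        - gap α m * recCoeff α (m + 1) * t ^ (2 * m + 4) * hr

/-- The left-hand side is the numerator of the derivative of `(P / Q) (1 + t) ^ α` for
`P = den (-α) m` and `Q = den α m`; it is a single monomial. -/
lemma eval_wronskian (α t : ℝ) (m : ℕ) :
    (1 + t) * ((derivative (den (-α) m)).eval t * (den α m).eval t
        - (den (-α) m).eval t * (derivative (den α m)).eval t)
      + α * ((den (-α) m).eval t * (den α m).eval t) = (2 * m + 1) * gap α m * t ^ (2 * m) :=
  (eval_wronskian_triple α t m).1

/-! ### Lower bounds for the denominators -/

/-- The factor `1 + c t`, with `c` the ratio of the leading coefficients of `den α (m + 1)` and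
`den α m`, is exactly what the recurrence preserves. -/
lemma eval_den_growth {α t : ℝ} (hα : α ∈ Set.Ioo (0 : ℝ) 1) (ht : 0 ≤ t) (m : ℕ) :
    0 < (den α m).eval t ∧
      (1 + (m + 1 + α) / (2 * (2 * m + 1)) * t) * (den α m).eval t ≤ (den α (m + 1)).eval t := by
  obtain ⟨h0, h1⟩ := hα
  induction m with
  | zero => simp [den]
  | succ m ih =>
    obtain ⟨hpos, hle⟩ := ih
    have hm : (0 : ℝ) ≤ m := m.cast_nonneg
    have hc : 0 ≤ (m + 1 + α) / (2 * (2 * m + 1)) * t := by positivity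
    have hpos' : 0 < (den α (m + 1)).eval t := by
      refine lt_of_lt_of_le ?_ hle
      positivity
    refine ⟨hpos', ?_⟩
    have e1 : (4 : ℝ) * ((m : ℝ) + 1) ^ 2 - 1 = (2 * m + 1) * (2 * m + 3) := by ring
    have hlam : recCoeff α (m + 1) =
        (m + 1 + α) / (2 * (2 * m + 1)) * ((m + 1 - α) / (2 * (2 * m + 3))) := by
      rw [recCoeff]
      push_cast
      rw [e1]
      field_simp
      ring
    have hd : 0 ≤ (m + 1 - α) / (2 * (2 * m + 3)) := div_nonneg (by linarith) (by positivity)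
    have hc' : ((m + 1 : ℕ) + 1 + α) / (2 * (2 * (m + 1 : ℕ) + 1))
        = 1 / 2 - (m + 1 - α) / (2 * (2 * m + 3)) := by
      push_cast
      rw [show (2 * ((m : ℝ) + 1) + 1) = 2 * m + 3 by ring]
      field_simp
      ring
    rw [eval_den_add_two, hlam, hc']
    have := mul_le_mul_of_nonneg_left hle (mul_nonneg hd ht)
    have h2 := mul_nonneg (mul_nonneg hd ht) hpos.le
    nlinarith

lemma eval_den_pos {α t : ℝ} (hα : α ∈ Set.Ioo (0 : ℝ) 1) (ht : 0 ≤ t) (m : ℕ) :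
    0 < (den α m).eval t :=
  (eval_den_growth hα ht m).1

lemma eval_den_le_succ {α t : ℝ} (hα : α ∈ Set.Ioo (0 : ℝ) 1) (ht : 0 ≤ t) (m : ℕ) :
    (den α m).eval t ≤ (den α (m + 1)).eval t := by
  refine le_trans ?_ (eval_den_growth hα ht m).2
  have := hα.1
  exact le_mul_of_one_le_left (eval_den_pos hα ht m).le (le_add_of_nonneg_right (by positivity))

lemma recCoeff_succ_le {α : ℝ} (m : ℕ) : recCoeff α (m + 1) ≤ 1 / 12 := by
  have hm : (0 : ℝ) ≤ m := m.cast_nonneg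
  rw [recCoeff]
  push_cast
  rw [div_le_iff₀ (by nlinarith)]
  nlinarith [sq_nonneg α]

/-- The slope `5 / 12` is at least `√2 - 1`, which makes `2 ^ (t / 2) ≤ 1 + (5 / 12) t` on `[0, 1]`,
and it leaves `(1 / 12) t` below `1 + t / 2`, which is enough to absorb the subtracted term of the
recurrence. -/
lemma mul_eval_den_le_succ {α t : ℝ} (hα : α ∈ Set.Ioo (0 : ℝ) 1) (ht : t ∈ Set.Icc (0 : ℝ) 1)
    (m : ℕ) : (1 + 5 / 12 * t) * (den α m).eval t ≤ (den α (m + 1)).eval t := by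
  obtain ⟨h0, h1⟩ := ht
  cases m with
  | zero => simp [den]; nlinarith [hα.1]
  | succ m =>
    have hpos := eval_den_pos hα h0 m
    have hle := eval_den_le_succ hα h0 m
    have a1 : recCoeff α (m + 1) * t ^ 2 * (den α m).eval t ≤
        1 / 12 * t ^ 2 * (den α m).eval t := by
      gcongr
      exact recCoeff_succ_le m
    have a2 : 1 / 12 * t ^ 2 * (den α m).eval t ≤ 1 / 12 * t * (den α (m + 1)).eval t := by
      gcongr
      nlinarith
    rw [eval_den_add_two]
    linarith

lemma two_rpow_le_sq_eval_den {α t : ℝ} (hα : α ∈ Set.Ioo (0 : ℝ) 1) (ht : t ∈ Set.Icc (0 : ℝ) 1)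
    (m : ℕ) : (2 : ℝ) ^ ((m : ℝ) * t) ≤ (den α m).eval t ^ 2 := by
  obtain ⟨h0, h1⟩ := ht
  have hb : (2 : ℝ) ^ t ≤ (1 + 5 / 12 * t) ^ 2 := by
    have hs : Real.sqrt 2 ≤ 17 / 12 := by rw [Real.sqrt_le_left (by norm_num)]; norm_num
    have h2 : (2 : ℝ) ^ t = (Real.sqrt 2 ^ t) ^ 2 := by
      rw [← Real.rpow_mul_natCast (Real.sqrt_nonneg 2), mul_comm, Real.rpow_natCast_mul
        (Real.sqrt_nonneg 2), Real.sq_sqrt (by norm_num)]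
    have h3 : Real.sqrt 2 ^ t ≤ 1 + 5 / 12 * t := by
      refine (Real.rpow_le_rpow (Real.sqrt_nonneg 2) hs h0).trans ?_
      have := rpow_one_add_le_one_add_mul_self (s := 5 / 12) (by norm_num) h0 h1
      norm_num at this ⊢
      linarith
    rw [h2]
    gcongr
  have hQ : (1 + 5 / 12 * t) ^ m ≤ (den α m).eval t := by
    induction m with
    | zero => simp [den]
    | succ m ih =>
      refine le_trans ?_ (mul_eval_den_le_succ hα ⟨h0, h1⟩ m)
      rw [pow_succ']
      gcongr
  calc (2 : ℝ) ^ ((m : ℝ) * t) = ((2 : ℝ) ^ t) ^ m := by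
        rw [mul_comm, Real.rpow_mul_natCast (by norm_num)]
    _ ≤ ((1 + 5 / 12 * t) ^ 2) ^ m := by gcongr
    _ = ((1 + 5 / 12 * t) ^ m) ^ 2 := pow_right_comm _ _ _
    _ ≤ _ := by gcongr

/-! ### The Padé property -/

lemma hasDerivAt_ratio (α : ℝ) (m : ℕ) {t : ℝ} (ht : -1 < t) (hQ : (den α m).eval t ≠ 0) :
    HasDerivAt (fun t => (den (-α) m).eval t / (den α m).eval t * (1 + t) ^ α)
      ((2 * m + 1) * gap α m * t ^ (2 * m) * ((1 + t) ^ (α - 1) / (den α m).eval t ^ 2)) t := by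
  have h1 : 1 + t ≠ 0 := by linarith
  have hp := (((den (-α) m).hasDerivAt t).div ((den α m).hasDerivAt t) hQ).mul
    (((hasDerivAt_id t).const_add 1).rpow_const (p := α) (Or.inl h1))
  refine hp.congr_deriv ?_
  have e : (1 + t) ^ α = (1 + t) * (1 + t) ^ (α - 1) := by
    rw [Real.rpow_sub_one h1]; field_simp
  simp only [id, Pi.div_apply]
  rw [e, ← eval_wronskian α t m]
  field_simp

lemma analyticAt_one_add_rpow (a : ℝ) : AnalyticAt ℝ (fun t : ℝ => (1 + t) ^ a) 0 :=
  Real.one_add_rpow_hasFPowerSeriesAt_zero.analyticAt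

lemma analyticAt_eval (P : ℝ[X]) (t : ℝ) : AnalyticAt ℝ (fun t => P.eval t) t :=
  AnalyticOnNhd.eval_polynomial P t trivial

/-- For analytic `f`, the condition on Taylor coefficients is an order of vanishing. -/
lemma isPade_iff {f : ℝ → ℝ} (hf : AnalyticAt ℝ f 0) {m n : ℕ} {P Q : ℝ[X]} :
    IsPade f m n P Q ↔ P.natDegree ≤ m ∧ Q.natDegree ≤ n ∧ Q.eval 0 = 1 ∧
      ((m + n + 1 : ℕ) : ℕ∞) ≤ analyticOrderAt (fun t => P.eval t / Q.eval t - f t) 0 := by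
  have key (h0 : Q.eval 0 = 1) :
      (∀ k ≤ m + n, iteratedDeriv k (fun t : ℝ => P.eval t / Q.eval t) 0 / (k.factorial : ℝ) =
        iteratedDeriv k f 0 / (k.factorial : ℝ)) ↔
      ((m + n + 1 : ℕ) : ℕ∞) ≤ analyticOrderAt (fun t => P.eval t / Q.eval t - f t) 0 := by
    have hr : AnalyticAt ℝ (fun t => P.eval t / Q.eval t) 0 :=
      (analyticAt_eval P 0).div (analyticAt_eval Q 0) (by simp [h0])
    rw [natCast_le_analyticOrderAt_iff_iteratedDeriv_eq_zero (hr.fun_sub hf)]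
    refine forall_congr' fun k => ?_
    rw [Nat.lt_succ_iff, iteratedDeriv_fun_sub hr.contDiffAt hf.contDiffAt, sub_eq_zero,
      div_left_inj' (by positivity)]
  constructor
  · rintro ⟨a, b, c, d⟩
    exact ⟨a, b, c, (key c).1 d⟩
  · rintro ⟨a, b, c, d⟩
    exact ⟨a, b, c, (key c).2 d⟩

/-- The quotient times `(1 + t) ^ α`, minus `1`, vanishes at `0` and has a derivative of order at
least `2 m` there. -/
lemma isPade_den (α : ℝ) (m : ℕ) : IsPade (powFun α) m m (den (-α) m) (den α m) := by
  have hf : AnalyticAt ℝ (powFun α) 0 := analyticAt_one_add_rpow (-α)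
  rw [isPade_iff hf]
  refine ⟨natDegree_den_le _ _, natDegree_den_le _ _, eval_den_zero _ _, ?_⟩
  have hQ0 : (den α m).eval 0 ≠ 0 := by simp [eval_den_zero]
  have hQ : AnalyticAt ℝ (fun t => (den α m).eval t) 0 := analyticAt_eval _ 0
  set D : ℝ → ℝ := fun t => (den (-α) m).eval t / (den α m).eval t * (1 + t) ^ α - 1 with hD
  have hDa : AnalyticAt ℝ D 0 :=
    (((analyticAt_eval (den (-α) m) 0).div hQ hQ0).mul
      (analyticAt_one_add_rpow α)).fun_sub analyticAt_const
  have hD0 : D 0 = 0 := by simp [hD, eval_den_zero]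
  have hgt : ∀ᶠ t : ℝ in 𝓝 0, -1 < t := lt_mem_nhds (by norm_num)
  have hne : ∀ᶠ t : ℝ in 𝓝 0, (den α m).eval t ≠ 0 := hQ.continuousAt.eventually_ne hQ0
  have hD' : ((2 * m : ℕ) : ℕ∞) ≤ analyticOrderAt (deriv D) 0 := by
    rw [natCast_le_analyticOrderAt hDa.deriv]
    refine ⟨fun t => (2 * m + 1) * gap α m * ((1 + t) ^ (α - 1) / (den α m).eval t ^ 2), ?_, ?_⟩
    · exact analyticAt_const.mul ((analyticAt_one_add_rpow (α - 1)).div (hQ.pow 2)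
        (pow_ne_zero 2 hQ0))
    · filter_upwards [hgt, hne] with t h1 h2
      rw [((hasDerivAt_ratio α m h1 h2).sub_const 1).deriv]
      simp only [sub_zero, smul_eq_mul]
      ring
  rw [analyticOrderAt_deriv_ge_iff hDa hD0, ← Nat.cast_add_one,
    natCast_le_analyticOrderAt hDa] at hD'
  obtain ⟨g, hg, hDg⟩ := hD'
  rw [natCast_le_analyticOrderAt (((analyticAt_eval (den (-α) m) 0).fun_div hQ hQ0).fun_sub hf)]
  refine ⟨fun t => g t * (1 + t) ^ (-α), hg.mul (analyticAt_one_add_rpow (-α)), ?_⟩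
  filter_upwards [hgt, hDg] with t h1 h2
  have h3 : (1 + t) ^ α * (1 + t) ^ (-α) = 1 := by
    rw [← Real.rpow_add (by linarith)]; simp
  simp only [hD, smul_eq_mul, sub_zero] at h2 ⊢
  rw [← two_mul]
  simp only [powFun]
  linear_combination (1 + t) ^ (-α) * h2 - (den (-α) m).eval t / (den α m).eval t * h3

lemma eq_zero_of_natDegree_lt_analyticOrderAt {p : ℝ[X]} {n : ℕ} (hp : p.natDegree < n)
    (h : (n : ℕ∞) ≤ analyticOrderAt (fun t => p.eval t) 0) : p = 0 := by
  by_contra h0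
  obtain ⟨q, hq, hq0⟩ := exists_eq_pow_rootMultiplicity_mul_and_not_dvd p h0 0
  have hq0' : q.eval 0 ≠ 0 := by
    rwa [dvd_iff_isRoot] at hq0
  have : analyticOrderAt (fun t => p.eval t) 0 = (p.rootMultiplicity 0 : ℕ) := by
    rw [(analyticAt_eval p 0).analyticOrderAt_eq_natCast]
    refine ⟨fun t => q.eval t, analyticAt_eval q 0, hq0', .of_forall fun t => ?_⟩
    conv_lhs => rw [hq]
    simp
  rw [this, Nat.cast_le] at h
  have := (count_roots p (a := 0) ▸ Multiset.count_le_card 0 p.roots).trans p.card_roots'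
  omega

/-- Two approximants of the same function satisfy `P₁ Q₂ = P₂ Q₁`: the difference vanishes to
an order exceeding its degree. -/
lemma _root_.IsPade.mul_eq_mul {f : ℝ → ℝ} (hf : AnalyticAt ℝ f 0) {m n : ℕ} {P₁ Q₁ P₂ Q₂ : ℝ[X]}
    (h₁ : IsPade f m n P₁ Q₁) (h₂ : IsPade f m n P₂ Q₂) : P₁ * Q₂ = P₂ * Q₁ := by
  rw [isPade_iff hf] at h₁ h₂
  obtain ⟨a₁, b₁, c₁, d₁⟩ := h₁
  obtain ⟨a₂, b₂, c₂, d₂⟩ := h₂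
  have hQ₁ := analyticAt_eval Q₁ 0
  have hQ₂ := analyticAt_eval Q₂ 0
  have e₁ : Q₁.eval 0 ≠ 0 := by simp [c₁]
  have e₂ : Q₂.eval 0 ≠ 0 := by simp [c₂]
  have r₁ := ((analyticAt_eval P₁ 0).fun_div hQ₁ e₁).fun_sub hf
  have r₂ := ((analyticAt_eval P₂ 0).fun_div hQ₂ e₂).fun_sub hf
  rw [natCast_le_analyticOrderAt r₁] at d₁
  rw [natCast_le_analyticOrderAt r₂] at d₂
  obtain ⟨g₁, hg₁, k₁⟩ := d₁
  obtain ⟨g₂, hg₂, k₂⟩ := d₂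
  rw [← sub_eq_zero]
  refine eq_zero_of_natDegree_lt_analyticOrderAt (n := m + n + 1) ?_ ?_
  · refine Nat.lt_succ_of_le ((natDegree_sub_le _ _).trans (max_le ?_ ?_))
    · exact natDegree_mul_le_of_le a₁ b₂
    · exact natDegree_mul_le_of_le a₂ b₁
  · rw [natCast_le_analyticOrderAt (analyticAt_eval _ 0)]
    refine ⟨fun t => (g₁ t - g₂ t) * (Q₁.eval t * Q₂.eval t),
      (hg₁.sub hg₂).mul (hQ₁.mul hQ₂), ?_⟩
    filter_upwards [k₁, k₂, hQ₁.continuousAt.eventually_ne e₁, hQ₂.continuousAt.eventually_ne e₂]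
      with t h1 h2 h3 h4
    simp only [smul_eq_mul, eval_sub, eval_mul] at h1 h2 ⊢
    have : P₁.eval t / Q₁.eval t - P₂.eval t / Q₂.eval t =
        (t - 0) ^ (m + n + 1) * (g₁ t - g₂ t) := by
      linear_combination h1 - h2
    rw [← mul_assoc, ← this]
    field_simp

/-- A common divisor divides `t ^ (2 m + 1)` by `eval_cross_succ`, and `den α m` is `1` at `0`. -/
lemma isCoprime_den {α : ℝ} (hα : α ∈ Set.Ioo (0 : ℝ) 1) (m : ℕ) :
    IsCoprime (den (-α) m) (den α m) := by
  have hX : IsCoprime (X ^ (2 * m + 1)) (den α m) := by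
    refine IsCoprime.pow_left ?_
    refine (irreducible_X.coprime_iff_not_dvd).2 fun h => ?_
    rw [X_dvd_iff, coeff_zero_eq_eval_zero, eval_den_zero] at h
    exact one_ne_zero h
  have hg : gap α m ≠ 0 := (gap_pos hα m).ne'
  obtain ⟨u, v, huv⟩ := hX
  refine ⟨u * C (gap α m)⁻¹ * den α (m + 1), v - u * C (gap α m)⁻¹ * den (-α) (m + 1), ?_⟩
  have hc : den (-α) m * den α (m + 1) - den (-α) (m + 1) * den α m
      = C (gap α m) * X ^ (2 * m + 1) := by
    refine Polynomial.funext fun t => ?_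
    simpa using eval_cross_succ α t m
  have hi : C (gap α m)⁻¹ * C (gap α m) = 1 := by rw [← C_mul, inv_mul_cancel₀ hg, C_1]
  linear_combination huv + u * C (gap α m)⁻¹ * hc + u * X ^ (2 * m + 1) * hi

/-- Cross multiplication and coprimality make `den α m` divide `Q`; as `den α m` has degree
exactly `m`, the quotient is constant, and it is `1` at `0`. -/
lemma _root_.IsPade.eq_den {α : ℝ} (hα : α ∈ Set.Ioo (0 : ℝ) 1) {m : ℕ} {P Q : ℝ[X]}
    (h : IsPade (powFun α) m m P Q) : P = den (-α) m ∧ Q = den α m := by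
  have hmul := h.mul_eq_mul (analyticAt_one_add_rpow (-α)) (isPade_den α m)
  obtain ⟨w, rfl⟩ : den α m ∣ Q :=
    (isCoprime_den hα m).symm.dvd_of_dvd_mul_left ⟨P, by rw [← hmul, mul_comm]⟩
  have hlead := coeff_den_pos (α := α) (by linarith [hα.1]) m
  have hne : den α m ≠ 0 := fun h0 => by simp [h0] at hlead
  have hw : w = 1 := by
    have hev := h.den_eval_zero
    rw [eval_mul, eval_den_zero, one_mul] at hev
    have hw0 : w ≠ 0 := fun h0 => by simp [h0] at hev
    have hdeg := h.natDegree_den_le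
    have := le_natDegree_of_ne_zero hlead.ne'
    rw [natDegree_mul hne hw0] at hdeg
    rw [eq_C_of_natDegree_le_zero (p := w) (by omega)] at hev ⊢
    rw [eval_C] at hev
    rw [hev, C_1]
  subst hw
  rw [mul_one] at hmul
  exact ⟨mul_right_cancel₀ hne hmul, mul_one _⟩

lemma padeR_eq {α : ℝ} (hα : α ∈ Set.Ioo (0 : ℝ) 1) (m : ℕ) (t : ℝ) :
    padeR α m t = (den (-α) m).eval t / (den α m).eval t := by
  have h : ∃ p : ℝ[X] × ℝ[X], IsPade (powFun α) m m p.1 p.2 := ⟨(_, _), isPade_den α m⟩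
  rw [padeR, padeApprox, dif_pos h, ((Classical.choose_spec h).eq_den hα).1,
    ((Classical.choose_spec h).eq_den hα).2]

/-! ### Monotonicity and the error estimate -/

lemma ratio_succ_lt {α t : ℝ} (hα : α ∈ Set.Ioo (0 : ℝ) 1) (ht : 0 < t) (m : ℕ) :
    (den (-α) (m + 1)).eval t / (den α (m + 1)).eval t <
      (den (-α) m).eval t / (den α m).eval t := by
  rw [div_lt_div_iff₀ (eval_den_pos hα ht.le _) (eval_den_pos hα ht.le _)]
  have := mul_pos (gap_pos hα m) (pow_pos ht (2 * m + 1))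
  rw [← eval_cross_succ] at this
  linarith

lemma continuousOn_ratio {α : ℝ} (hα : α ∈ Set.Ioo (0 : ℝ) 1) (m : ℕ) :
    ContinuousOn (fun t => (den (-α) m).eval t / (den α m).eval t * (1 + t) ^ α) (Set.Ici 0) :=
  fun t ht => (hasDerivAt_ratio α m (by linarith [Set.mem_Ici.1 ht])
    (eval_den_pos hα ht m).ne').continuousAt.continuousWithinAt

lemma rpow_neg_lt_ratio {α t : ℝ} (hα : α ∈ Set.Ioo (0 : ℝ) 1) (ht : 0 < t) (m : ℕ) :
    (1 + t) ^ (-α) < (den (-α) m).eval t / (den α m).eval t := by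
  have hmono : StrictMonoOn
      (fun t => (den (-α) m).eval t / (den α m).eval t * (1 + t) ^ α) (Set.Ici 0) := by
    refine strictMonoOn_of_deriv_pos (convex_Ici 0) (continuousOn_ratio hα m) fun s hs => ?_
    rw [interior_Ici, Set.mem_Ioi] at hs
    have hQ := eval_den_pos hα hs.le m
    rw [(hasDerivAt_ratio α m (by linarith) hQ.ne').deriv]
    have := gap_pos hα m
    positivity
  have h := hmono Set.self_mem_Ici ht.le ht
  simp only [eval_den_zero, add_zero, Real.one_rpow, div_one, mul_one] at h
  rw [Real.rpow_neg (by linarith), inv_lt_iff_one_lt_mul₀ (by positivity)]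
  exact h

/-- After multiplication by `(1 + t) ^ α`, both sides are `0` at `t = 0`. Their derivatives are
compared with the help of `2 ^ (m t) ≤ (den α m) ^ 2` and
`2 m + 1 ≤ (2 m + 1 - m t log 2) (1 + t) + α t`. -/
lemma ratio_sub_le {α t : ℝ} (hα : α ∈ Set.Ioo (0 : ℝ) 1) (ht : t ∈ Set.Icc (0 : ℝ) 1) (m : ℕ) :
    (den (-α) m).eval t / (den α m).eval t - (1 + t) ^ (-α) ≤
      gap α m * (t ^ (2 * m + 1) / (2 : ℝ) ^ ((m : ℝ) * t)) := by
  set D : ℝ → ℝ := fun t => (den (-α) m).eval t / (den α m).eval t * (1 + t) ^ α with hD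
  set E : ℝ → ℝ :=
    fun t => gap α m * (t ^ (2 * m + 1) * (2 : ℝ) ^ (-((m : ℝ) * t))) * (1 + t) ^ α with hE
  set E' : ℝ → ℝ := fun t => gap α m * t ^ (2 * m) * (2 : ℝ) ^ (-((m : ℝ) * t)) *
    (1 + t) ^ (α - 1) * ((2 * m + 1 - m * t * Real.log 2) * (1 + t) + α * t) with hE'
  have hderiv (s : ℝ) (hs : 0 ≤ s) : HasDerivAt E (E' s) s := by
    have h1 : 1 + s ≠ 0 := by linarith
    have e : (1 + s) ^ α = (1 + s) * (1 + s) ^ (α - 1) := by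
      rw [Real.rpow_sub_one h1]; field_simp
    have hexp : HasDerivAt (fun s : ℝ => (2 : ℝ) ^ (-((m : ℝ) * s)))
        (Real.log 2 * (-((m : ℝ) * 1)) * (2 : ℝ) ^ (-((m : ℝ) * s))) s :=
      (((hasDerivAt_id s).const_mul (m : ℝ)).neg).const_rpow (by norm_num)
    refine ((((hasDerivAt_pow (2 * m + 1) s).mul hexp).const_mul (gap α m)).mul
      (((hasDerivAt_id s).const_add 1).rpow_const (p := α) (Or.inl h1))).congr_deriv ?_
    simp only [hE', id, Pi.mul_apply, e, Nat.add_sub_cancel]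
    push_cast
    ring
  have hcont : ContinuousOn (fun s => E s - D s) (Set.Icc 0 1) := fun s hs =>
    ((hderiv s hs.1).continuousAt.continuousWithinAt).sub
      ((continuousOn_ratio hα m).mono Set.Icc_subset_Ici_self s hs)
  have hmono : MonotoneOn (fun s => E s - D s) (Set.Icc 0 1) := by
    have hd (s : ℝ) (hs : s ∈ Set.Ioo (0 : ℝ) 1) := (hderiv s hs.1.le).sub
      (hasDerivAt_ratio α m (by linarith [hs.1]) (eval_den_pos hα hs.1.le m).ne')
    refine monotoneOn_of_deriv_nonneg (convex_Icc 0 1) hcont ?_ ?_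
    · rw [interior_Icc]
      exact fun s hs => (hd s hs).differentiableAt.differentiableWithinAt
    · rw [interior_Icc]
      intro s hs
      refine ((hd s hs).deriv.symm ▸ ?_ : 0 ≤ deriv (E - D) s)
      obtain ⟨hs0, hs1⟩ := hs
      have hg := gap_pos hα m
      have hQ := eval_den_pos hα hs0.le m
      have hsq := two_rpow_le_sq_eval_den hα ⟨hs0.le, hs1.le⟩ m
      have hinv : 1 / (den α m).eval s ^ 2 ≤ (2 : ℝ) ^ (-((m : ℝ) * s)) := by
        rw [Real.rpow_neg (by norm_num), ← one_div]
        exact one_div_le_one_div_of_le (by positivity) hsq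
      have hfac : (2 * m + 1 : ℝ) ≤ (2 * m + 1 - m * s * Real.log 2) * (1 + s) + α * s := by
        have hl : Real.log 2 ≤ 1 := by linarith [Real.log_two_lt_d9]
        have hl0 : 0 ≤ Real.log 2 := Real.log_nonneg (by norm_num)
        have hms : (0 : ℝ) ≤ m * s := by positivity
        have h1 : m * s * Real.log 2 * (1 + s) ≤ m * s * 1 * 2 := by
          gcongr
          linarith
        have := mul_pos hα.1 hs0
        linarith
      have hle := mul_le_mul hinv hfac (by positivity) (by positivity)
      have hpos : 0 ≤ gap α m * s ^ (2 * m) * (1 + s) ^ (α - 1) := by positivity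
      have := mul_le_mul_of_nonneg_left hle hpos
      rw [sub_nonneg]
      refine le_trans (le_of_eq ?_) (this.trans (le_of_eq ?_))
      · ring
      · simp only [hE']; ring
  have h := hmono (Set.left_mem_Icc.2 zero_le_one) ht ht.1
  have hD0 : D 0 = 1 := by simp [hD, eval_den_zero]
  have hE0 : E 0 = 0 := by simp [hE]
  beta_reduce at h
  rw [hD0, hE0] at h
  have hp : (0 : ℝ) < (1 + t) ^ α := Real.rpow_pos_of_pos (by linarith [ht.1]) _
  have hi : (1 + t) ^ (-α) * (1 + t) ^ α = 1 := by
    rw [← Real.rpow_add (by linarith [ht.1])]; simp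
  refine le_of_mul_le_mul_right ?_ hp
  rw [sub_mul, hi, div_eq_mul_inv (t ^ (2 * m + 1)), ← Real.rpow_neg (by norm_num)]
  simp only [hE, hD] at h
  linarith

/-! ### The constant -/

lemma padeConst_eq {α : ℝ} (hα : α ∈ Set.Ioo (0 : ℝ) 1) :
    padeConst α = Real.sin (Real.pi * α) / 2 := by
  have hs : Real.sin (Real.pi * α) ≠ 0 :=
    (Real.sin_pos_of_pos_of_lt_pi (mul_pos Real.pi_pos hα.1)
      (by nlinarith [Real.pi_pos, hα.2])).ne'
  have h1 := Real.Gamma_mul_Gamma_one_sub α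
  have h2 : Real.Gamma (1 + α) = α * Real.Gamma α := by
    rw [add_comm, Real.Gamma_add_one hα.1.ne']
  have h3 : 2 * Real.Gamma (1 - α) * Real.Gamma (1 + α) =
      2 * α * (Real.pi / Real.sin (Real.pi * α)) := by
    rw [h2, ← h1]; ring
  have := hα.1.ne'
  rw [padeConst, h3]
  field_simp

/-- The factor `recCoeff α j` is `1 / 16` times a factor of Euler's sine product and a factor
of Wallis' product. -/
lemma gap_eq (α : ℝ) (m : ℕ) :
    gap α m = (1 / 16) ^ m * (α * ∏ j ∈ Finset.range m, (1 - α ^ 2 / ((j : ℝ) + 1) ^ 2)) *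
      Real.Wallis.W m := by
  induction m with
  | zero => simp [gap, Real.Wallis.W]
  | succ m ih =>
    have hm : (0 : ℝ) ≤ m := m.cast_nonneg
    have e1 : (4 : ℝ) * ((m : ℝ) + 1) ^ 2 - 1 = (2 * m + 1) * (2 * m + 3) := by ring
    have hr : recCoeff α (m + 1) = 1 / 16 * (1 - α ^ 2 / ((m : ℝ) + 1) ^ 2) *
        ((2 * m + 2) / (2 * m + 1) * ((2 * m + 2) / (2 * m + 3))) := by
      rw [recCoeff]
      push_cast
      rw [e1]
      field_simp
      ring
    rw [gap_succ, ih, hr, Finset.prod_range_succ, Real.Wallis.W_succ]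
    ring

/-- The partial products of Euler's sine product, multiplied by `N / (N + 1)`, increase: the
factor compensates exactly for the case `α = 1`. -/
lemma prod_le_sin {α : ℝ} (hα : α ∈ Set.Ioo (0 : ℝ) 1) (m : ℕ) :
    Real.pi * α * (∏ j ∈ Finset.range m, (1 - α ^ 2 / ((j : ℝ) + 1) ^ 2)) * (m / (m + 1)) ≤
      Real.sin (Real.pi * α) := by
  obtain ⟨h0, h1⟩ := hα
  have hlim := (Real.tendsto_euler_sin_prod α).mul (tendsto_natCast_div_add_atTop (1 : ℝ))
  rw [mul_one] at hlim
  refine Monotone.ge_of_tendsto (monotone_nat_of_le_succ fun n => ?_) hlim m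
  have hsq : α ^ 2 ≤ 1 := by nlinarith
  have hp : 0 ≤ ∏ j ∈ Finset.range n, (1 - α ^ 2 / ((j : ℝ) + 1) ^ 2) := by
    refine Finset.prod_nonneg fun j _ => sub_nonneg.2 (div_le_one_of_le₀ ?_ (by positivity))
    nlinarith [j.cast_nonneg (α := ℝ)]
  have hfac : (n : ℝ) / (n + 1) ≤
      (1 - α ^ 2 / ((n : ℝ) + 1) ^ 2) * (((n + 1 : ℕ) : ℝ) / ((n + 1 : ℕ) + 1)) := by
    calc (n : ℝ) / (n + 1) =
        (1 - 1 / ((n : ℝ) + 1) ^ 2) * (((n + 1 : ℕ) : ℝ) / ((n + 1 : ℕ) + 1)) := by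
          push_cast
          field_simp
          ring
      _ ≤ _ := by gcongr
  rw [Finset.prod_range_succ, ← mul_assoc, mul_assoc _ (1 - _) (_ / _)]
  have := Real.pi_pos
  gcongr

/-- Asymptotically sharp, with a relative error that is uniform in `α`. -/
lemma gap_le {α : ℝ} (hα : α ∈ Set.Ioo (0 : ℝ) 1) {m : ℕ} (hm : 1 ≤ m) :
    gap α m ≤ (1 + 1 / m) * padeConst α * (1 / 16) ^ m := by
  have hm' : (0 : ℝ) < m := by exact_mod_cast hm
  have hpi := Real.pi_pos
  set p := ∏ j ∈ Finset.range m, (1 - α ^ 2 / ((j : ℝ) + 1) ^ 2) with hp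
  have h1 : Real.pi * α * p * (m / (m + 1)) ≤ Real.sin (Real.pi * α) := prod_le_sin hα m
  have hW := Real.Wallis.W_le m
  have hp0 : 0 ≤ α * p := by
    refine mul_nonneg hα.1.le (Finset.prod_nonneg fun j _ =>
      sub_nonneg.2 (div_le_one_of_le₀ ?_ (by positivity)))
    nlinarith [j.cast_nonneg (α := ℝ), hα.1, hα.2]
  have h2 : α * p * Real.Wallis.W m ≤ (1 + 1 / m) * padeConst α := by
    calc α * p * Real.Wallis.W m ≤ α * p * (Real.pi / 2) := by gcongr
      _ = (1 + 1 / m) * (Real.pi * α * p * (m / (m + 1)) / 2) := by field_simp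
      _ ≤ (1 + 1 / m) * (Real.sin (Real.pi * α) / 2) := by gcongr
      _ = _ := by rw [padeConst_eq hα]
  rw [gap_eq, mul_assoc, mul_comm]
  gcongr

lemma padeR_sub_le {α t : ℝ} (hα : α ∈ Set.Ioo (0 : ℝ) 1) (ht : t ∈ Set.Icc (0 : ℝ) 1) {m : ℕ}
    (hm : 1 ≤ m) :
    padeR α m t - (1 + t) ^ (-α) ≤ (1 + 1 / m) * padeConst α * padeRate m t := by
  have h16 : (2 : ℝ) ^ (-4 * (m : ℝ)) = (1 / 16) ^ m := by
    rw [Real.rpow_mul_natCast (by norm_num)]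
    norm_num
  have ht0 := ht.1
  rw [padeR_eq hα, padeRate, h16]
  calc _ ≤ gap α m * (t ^ (2 * m + 1) / (2 : ℝ) ^ ((m : ℝ) * t)) := ratio_sub_le hα ht m
    _ ≤ ((1 + 1 / m) * padeConst α * (1 / 16) ^ m) *
        (t ^ (2 * m + 1) / (2 : ℝ) ^ ((m : ℝ) * t)) := by
      gcongr
      exact gap_le hα hm
    _ = _ := by ring

lemma padeConst_pos {α : ℝ} (hα : α ∈ Set.Ioo (0 : ℝ) 1) : 0 < padeConst α := by
  have := hα.1
  have := Real.pi_pos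
  have := Real.Gamma_pos_of_pos (sub_pos.2 hα.2)
  have := Real.Gamma_pos_of_pos (show 0 < 1 + α by linarith)
  unfold padeConst
  positivity

lemma padeRate_nonneg (m : ℕ) {t : ℝ} (ht : 0 ≤ t) : 0 ≤ padeRate m t := by
  unfold padeRate
  positivity

end PowPade

theorem mainTheorem1 :
    -- the diagonal approximants exist and are unique
    (∀ α ∈ Set.Ioo (0 : ℝ) 1, ∀ m : ℕ,
      ∃! p : Polynomial ℝ × Polynomial ℝ, IsPade (powFun α) m m p.1 p.2) ∧
    -- monotonicity in `m`, strict away from the interpolation point `t = 0`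
    (∀ α ∈ Set.Ioo (0 : ℝ) 1,
      (∀ t : ℝ, 0 ≤ t → padeR α 0 t = 1) ∧
      (∀ m : ℕ, padeR α m 0 = 1) ∧
      (∀ t : ℝ, 0 < t → ∀ m : ℕ,
        padeR α (m + 1) t < padeR α m t ∧ (1 + t) ^ (-α) < padeR α m t)) ∧
    -- error bound with a constant comparable to `padeConst α`, uniformly in `α`
    (∃ c' : ℝ → ℝ, ∃ A B : ℝ, 0 < A ∧ 0 < B ∧
      ∀ α ∈ Set.Ioo (0 : ℝ) 1,
        A * padeConst α ≤ c' α ∧ c' α ≤ B * padeConst α ∧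
        ∀ m : ℕ, 1 ≤ m → ∀ t ∈ Set.Icc (0 : ℝ) 1,
          padeR α m t - (1 + t) ^ (-α) ≤ c' α * padeRate m t) ∧
    -- for large `m` the constant may be taken arbitrarily close to `padeConst α`
    (∀ ε : ℝ, 0 < ε → ∃ M : ℕ, ∀ m : ℕ, M ≤ m → ∀ α ∈ Set.Ioo (0 : ℝ) 1,
      ∀ t ∈ Set.Icc (0 : ℝ) 1,
        padeR α m t - (1 + t) ^ (-α) ≤ (1 + ε) * padeConst α * padeRate m t) := by
  refine ⟨fun α hα m => ⟨(PowPade.den (-α) m, PowPade.den α m), PowPade.isPade_den α m,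
    fun p hp => Prod.ext_iff.2 (hp.eq_den hα)⟩, fun α hα => ⟨fun t _ => ?_, fun m => ?_,
    fun t ht m => ⟨?_, ?_⟩⟩, ⟨fun α => 2 * padeConst α, 1, 2, one_pos, two_pos,
    fun α hα => ⟨?_, le_rfl, fun m hm t ht => ?_⟩⟩, fun ε hε => ?_⟩
  · simp [PowPade.padeR_eq hα, PowPade.den]
  · simp [PowPade.padeR_eq hα, PowPade.eval_den_zero]
  · rw [PowPade.padeR_eq hα, PowPade.padeR_eq hα]
    exact PowPade.ratio_succ_lt hα ht m
  · rw [PowPade.padeR_eq hα]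
    exact PowPade.rpow_neg_lt_ratio hα ht m
  · have := PowPade.padeConst_pos hα
    linarith
  · refine (PowPade.padeR_sub_le hα ht hm).trans ?_
    have := PowPade.padeConst_pos hα
    have := PowPade.padeRate_nonneg m ht.1
    have : 1 / (m : ℝ) ≤ 1 := by
      rw [div_le_one (by exact_mod_cast hm)]
      exact_mod_cast hm
    beta_reduce
    gcongr
    linarith
  · obtain ⟨n, hn⟩ := exists_nat_one_div_lt hε
    refine ⟨n + 1, fun m hm α hα t ht => (PowPade.padeR_sub_le hα ht (by omega)).trans ?_⟩
    have := PowPade.padeConst_pos hα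
    have := PowPade.padeRate_nonneg m ht.1
    have hle : 1 / (m : ℝ) ≤ ε := by
      refine le_trans ?_ hn.le
      gcongr
      exact_mod_cast hm
    gcongr
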